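/- Let $N\ge 1$ and let $S=(S_{xy})_{x,y=1}^N$ be a real symmetric matrix with nonnegative entries. For every $z\in\mathbb C$ with $\operatorname{Im} z>0$ the quadratic vector equation $$-\frac1{m_x}=z+\sum_{y=1}^N S_{xy}m_y,\qquad x=1,\dots,N,$$ has a unique solution $m(z)=(m_x(z))_{x=1}^N\in\mathbb C^N$ with $\operatorname{Im} m_x(z)>0$ for all $x$, and there is a unique probability measure $\rho$ on $\mathbb R$ (the self-consistent density of states) with $$\int f\,d\rho=\lim_{\eta\downarrow0}\int_{\mathbb R} f(\tau)\,\frac1{\pi N}\sum_{x=1}^N\operatorname{Im} m_x(\tau+i\eta)\,d\tau$$ for every continuous compactly supported $f:\mathbb R\to\mathbb R$. Write $\|M\|=\max_x\sum_y|M_{xy}|$ and, for $j\ge1$, $z_j=\|S^j\|/\|S\|^j$ (with $z_j:=0$ if $S=0$). For every $J\in\mathbb N\cup\{\infty\}$ (including $J=0$), the function $$\varphi_J(w)=1-\frac w2\Big(1+\sum_{1\le j\le J}\Big(\frac w2\Big)^jz_j+\sum_{j>J}\Big(\frac w2\Big)^j\Big)$$ has a smallest positive root $w_c(J)$ (among the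 points $w$ where the series converge), the support of $\rho$ has a maximum, and $$\max\operatorname{supp}\rho\le\frac{2\|S\|^{1/2}}{w_c(J)}.$$ This improves the bound $2\|S\|^{1/2}$: one has $w_c(J)\ge1$, and $w_c(J)>1$ if $z_j<1$ for some $1\le j\le J$. -/

import Mathlib

open MeasureTheory Filter Topology

-- Square matrices carry the norm induced by the maximum norm, i.e. the maximal absolute row sum.
attribute [local instance] Matrix.linftyOpNormedRing

theorem matrix_norm_eq_maxRowSum {N : ℕ} (M : Matrix (Fin N) (Fin N) ℝ) :
    ‖M‖ = ⨆ x, ∑ y, |M x y| := by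
  rw [Matrix.linfty_opNorm_def, Finset.sup_univ_eq_ciSup, NNReal.coe_iSup]
  simp

/-- `m` is a solution, with all components in the upper half plane, of the quadratic vector
equation `-1 / m x = z + ∑ y, S x y * m y` at the spectral parameter `z`. -/
def IsQVESolution {N : ℕ} (S : Matrix (Fin N) (Fin N) ℝ) (z : ℂ) (m : Fin N → ℂ) : Prop :=
  ∀ x, 0 < (m x).im ∧ -1 / m x = z + ∑ y, (S x y : ℂ) * m y

/-- The probability measure `ρ` is the self-consistent density of states of `S`: it is the limit,
as `η ↓ 0`, of the measures `(π N)⁻¹ ∑ x, Im m x (τ + i η) dτ`, where `m` is the solution of the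
quadratic vector equation on the upper half plane. The limit is tested against continuous
functions of compact support. -/
structure IsSelfConsistentDOS {N : ℕ} (S : Matrix (Fin N) (Fin N) ℝ) (ρ : Measure ℝ) : Prop where
  isProbabilityMeasure : IsProbabilityMeasure ρ
  isLimit : ∃ m : ℂ → Fin N → ℂ, (∀ z : ℂ, 0 < z.im → IsQVESolution S z (m z)) ∧
    ∀ f : ℝ → ℝ, Continuous f → HasCompactSupport f →
      Tendsto
        (fun η : ℝ => ∫ τ : ℝ, f τ * (1 / (Real.pi * N) *
          ∑ x, (m ((τ : ℂ) + (η : ℂ) * Complex.I) x).im))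
        (𝓝[>] 0) (𝓝 (∫ τ, f τ ∂ρ))

/-- `z_j = ‖S ^ j‖ / ‖S‖ ^ j`. For `S = 0` and `j ≥ 1` this is `0 / 0 = 0`. -/
noncomputable def normRatio {N : ℕ} (S : Matrix (Fin N) (Fin N) ℝ) (j : ℕ) : ℝ :=
  ‖S ^ j‖ / ‖S‖ ^ j

/-- The term of index `j` of the series in `φ_J`, namely `(w / 2) ^ j * z_j` for `j ≤ J`
and `(w / 2) ^ j` for `j > J`. -/
noncomputable def phiTerm {N : ℕ} (S : Matrix (Fin N) (Fin N) ℝ) (J : ℕ∞) (w : ℝ) (j : ℕ) : ℝ :=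
  open Classical in (w / 2) ^ j * (if (j : ℕ∞) ≤ J then normRatio S j else 1)

/-- `φ_J(w) = 1 - (w / 2) (1 + ∑_{j = 1}^J (w / 2) ^ j z_j + ∑_{j > J} (w / 2) ^ j)`; the two
series over `j ≥ 1` are written as one, with index `j + 1`. -/
noncomputable def phi {N : ℕ} (S : Matrix (Fin N) (Fin N) ℝ) (J : ℕ∞) (w : ℝ) : ℝ :=
  1 - w / 2 * (1 + ∑' j : ℕ, phiTerm S J w (j + 1))

/-- The positive roots of `φ_J`, among the points where its series converges. -/
def phiPosRoots {N : ℕ} (S : Matrix (Fin N) (Fin N) ℝ) (J : ℕ∞) : Set ℝ :=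
  {w | 0 < w ∧ Summable (fun j : ℕ => phiTerm S J w (j + 1)) ∧ phi S J w = 0}

/-! The solution is a diagonal resolvent entry of a self-adjoint operator. On the lists over `Fin
N`, join `x :: w` to `y :: x :: w` by an edge of weight `√(S x y)`. The component of `[x]` is a tree
with root `[x]`, and at each child `[y, x]` hangs a copy of the component of `[y]`. For the weighted
adjacency operator `T`, the Schur complement formula at the root turns this self-similarity into the
quadratic vector equation for `⟨e_[x], (T - z)⁻¹ e_[x]⟩` (`isQVESolution_of_treeResolvent`). Hence
`ρ` is the mean of the spectral measures of `T` at the `N` roots, and every upper bound of `T`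
bounds its support.

A Schur test gives `T ≤ L` as soon as some `v > 0` satisfies `1 / v + S v ≤ L`
(`treeShift_add_adjoint_le`). For `S ≠ 0`, take the Neumann series `V = u ∑ j, (u S / ‖S‖) ^ j 1`
with `u = w_c / 2`. The equation `φ_J(w_c) = 0` says that the majorant of this series equals 1, so
`u ≤ V ≤ 1`, and `v = V / √‖S‖` works with `L = 2 √‖S‖ / w_c` (`exists_supersolution`). At `w = 1`
the majorant is dominated by a geometric series of sum 1, whence `w_c ≥ 1`. Uniqueness is a maximum
argument for the difference of two solutions, weighted by their imaginary parts
(`IsQVESolution.unique`). -/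

/-! ### Spectral measures and resolvents of a bounded self-adjoint operator -/

section SpectralMeasure
variable {H : Type*} [NormedAddCommGroup H] [InnerProductSpace ℂ H] [CompleteSpace H]

/-- A positive normalised functional on the bounded operators induces, through the continuous
functional calculus of a self-adjoint operator, a probability measure on its spectrum. -/
theorem exists_spectralMeasure (T : H →L[ℂ] H) (hT : IsSelfAdjoint T)
    (φ : (H →L[ℂ] H) →ₗ[ℝ] ℝ) (hφ : ∀ a, 0 ≤ a → 0 ≤ φ a) (hφ1 : φ 1 = 1) :
    ∃ μ : Measure ℝ, IsProbabilityMeasure μ ∧ μ (spectrum ℝ T)ᶜ = 0 ∧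
      ∀ g : ℝ → ℝ, Continuous g → ∫ t, g t ∂μ = φ (cfc g T) := by
  have hcomp : CompactSpace (spectrum ℝ T) := isCompact_iff_compactSpace.mp
    (ContinuousFunctionalCalculus.isCompact_spectrum T)
  -- The spectrum is compact, so Riesz–Markov–Kakutani applies to `f ↦ φ (f(T))`.
  let Λ : CompactlySupportedContinuousMap (spectrum ℝ T) ℝ →ₚ[ℝ] ℝ := PositiveLinearMap.mk₀
    { toFun := fun f => φ (cfcHom hT f.toContinuousMap)
      map_add' := fun f g => by
        rw [← map_add, ← map_add]; rfl
      map_smul' := fun c f => by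
        rw [RingHom.id_apply, ← map_smul, ← map_smul]; rfl }
    (fun f hf => hφ _ (cfcHom_nonneg_iff hT |>.mpr fun x => hf x))
  set ν := RealRMK.rieszMeasure Λ with hν
  have hint (f : C(spectrum ℝ T, ℝ)) : ∫ t, f t ∂ν = φ (cfcHom hT f) :=
    RealRMK.integral_rieszMeasure Λ (CompactlySupportedContinuousMap.continuousMapEquiv f)
  have hprob : IsProbabilityMeasure ν := by
    have h1 := hint 1
    rw [map_one, hφ1] at h1
    simp only [ContinuousMap.one_apply, integral_const, smul_eq_mul, mul_one] at h1
    exact ⟨(ENNReal.toReal_eq_one_iff _).mp h1⟩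
  have hme : MeasurableEmbedding (Subtype.val : spectrum ℝ T → ℝ) :=
    MeasurableEmbedding.subtype_coe
      (ContinuousFunctionalCalculus.isCompact_spectrum T).isClosed.measurableSet
  refine ⟨ν.map Subtype.val, Measure.isProbabilityMeasure_map hme.measurable.aemeasurable, ?_, ?_⟩
  · rw [hme.map_apply]
    simp
  · intro g hg
    rw [hme.integral_map, cfc_apply g T hT hg.continuousOn]
    exact hint ⟨_, _⟩

theorem isUnit_sub_algebraMap_of_im_ne_zero {T : H →L[ℂ] H} (hT : IsSelfAdjoint T) {z : ℂ}
    (hz : z.im ≠ 0) : IsUnit (T - algebraMap ℂ (H →L[ℂ] H) z) := by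
  have h : z ∉ spectrum ℂ T := fun h => hz (by
    have := hT.mem_spectrum_eq_re h
    rw [this]; simp)
  rw [← neg_sub, IsUnit.neg_iff]
  exact spectrum.notMem_iff.mp h

theorem exists_resolvent_apply {T : H →L[ℂ] H} (hT : IsSelfAdjoint T) {z : ℂ}
    (hz : z.im ≠ 0) (e : H) : ∃ g : H, T g - z • g = e := by
  obtain ⟨u, hu⟩ := isUnit_sub_algebraMap_of_im_ne_zero hT hz
  refine ⟨(u⁻¹ : (H →L[ℂ] H)ˣ).1 e, ?_⟩
  have h : (u.1 * (u⁻¹ : (H →L[ℂ] H)ˣ).1) e = e := by rw [Units.mul_inv]; rfl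
  rw [hu] at h
  simpa [Algebra.algebraMap_eq_smul_one] using h

theorem resolvent_apply_unique {T : H →L[ℂ] H} (hT : IsSelfAdjoint T) {z : ℂ}
    (hz : z.im ≠ 0) {g g' : H} (h : T g - z • g = T g' - z • g') : g = g' := by
  obtain ⟨u, hu⟩ := isUnit_sub_algebraMap_of_im_ne_zero hT hz
  have key (x : H) : (u⁻¹ : (H →L[ℂ] H)ˣ).1 (T x - z • x) = x := by
    have h : ((u⁻¹ : (H →L[ℂ] H)ˣ).1 * u.1) x = x := by rw [Units.inv_mul]; rfl
    rw [hu] at h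
    simpa [Algebra.algebraMap_eq_smul_one] using h
  rw [← key g, h, key]

/-- `⟨T g, g⟩` is real, so only the term with `z` contributes. -/
theorem im_inner_resolvent {T : H →L[ℂ] H} (hT : IsSelfAdjoint T) {z : ℂ} {e g : H}
    (hg : T g - z • g = e) : (inner ℂ e g).im = z.im * ‖g‖ ^ 2 := by
  have h : (inner ℂ (T g) g).im = 0 := by
    have := hT.isSymmetric g g
    rw [← Complex.conj_eq_iff_im, inner_conj_symm]
    exact this.symm
  rw [← hg, inner_sub_left, inner_smul_left, Complex.sub_im, h, inner_self_eq_norm_sq_to_K]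
  simp [← Complex.ofReal_pow]

/-- The imaginary part of a diagonal resolvent entry as a quadratic form of the Poisson kernel. -/
theorem norm_sq_resolvent {T : H →L[ℂ] H} (hT : IsSelfAdjoint T) {τ η : ℝ} (hη : 0 < η) {e g : H}
    (hg : T g - ((τ : ℂ) + η * Complex.I) • g = e) :
    η * ‖g‖ ^ 2 = (inner ℂ e (cfc (fun t : ℝ => η / ((t - τ) ^ 2 + η ^ 2)) T e)).re := by
  have hpos (t : ℝ) : 0 < (t - τ) ^ 2 + η ^ 2 := by positivity
  set C := cfc (fun t : ℝ => η / ((t - τ) ^ 2 + η ^ 2)) T with hC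
  have hcont : Continuous fun t : ℝ => η / ((t - τ) ^ 2 + η ^ 2) :=
    continuous_const.div (by fun_prop) fun t => (hpos t).ne'
  have hB : (cfc (fun t : ℝ => (t - τ) ^ 2 + η ^ 2) T) * C = algebraMap ℝ _ η := by
    rw [hC, ← cfc_mul _ _ T (by fun_prop) hcont.continuousOn, ← cfc_const η T hT]
    refine cfc_congr fun t _ => ?_
    have := (hpos t).ne'
    field_simp
  have hB' : cfc (fun t : ℝ => (t - τ) ^ 2 + η ^ 2) T
      = (T - algebraMap ℝ _ τ) ^ 2 + algebraMap ℝ _ (η ^ 2) := by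
    rw [cfc_add (a := T) (fun t : ℝ => (t - τ) ^ 2) (fun _ => η ^ 2) (by fun_prop) (by fun_prop),
      cfc_pow (fun t : ℝ => t - τ) 2 T (by fun_prop) hT,
      cfc_sub (fun t : ℝ => t) (fun _ => τ) T (by fun_prop) (by fun_prop),
      cfc_const _ T hT, cfc_const _ T hT, cfc_id' ℝ T hT]
  set k := C e with hk
  set z : ℂ := (τ : ℂ) + η * Complex.I with hz
  have hBk : (cfc (fun t : ℝ => (t - τ) ^ 2 + η ^ 2) T) k = (η : ℂ) • e := by
    rw [hk, ← mul_apply_eq_comp, hB]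
    simp [Algebra.algebraMap_eq_smul_one]
  set zb : ℂ := (τ : ℂ) - η * Complex.I with hzb
  have hzim : z.im ≠ 0 := by simp [hz, hη.ne']
  -- The Poisson kernel is `η (t - z)⁻¹ (t - z̄)⁻¹`, so `k = η (T - z̄)⁻¹ g`. Moving one resolvent
  -- across the inner product then leaves `η ⟨g, g⟩`.
  have hg' : T k - zb • k = (η : ℂ) • g := by
    apply resolvent_apply_unique hT hzim
    rw [map_smul, smul_comm z (η : ℂ) g, ← smul_sub, hg, ← hBk, hB', pow_two]
    have h1 (r : ℝ) (x : H) : (algebraMap ℝ (H →L[ℂ] H) r) x = (r : ℂ) • x := by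
      simp [Algebra.algebraMap_eq_smul_one]
    simp only [add_apply, mul_apply_eq_comp,
      sub_apply, h1, map_sub, map_smul]
    have h2 : (η : ℂ) ^ 2 = z * zb - (τ : ℂ) ^ 2 := by
      rw [hz, hzb]; ring_nf; simp [Complex.I_sq]
    have h3 : zb = 2 * τ - z := by rw [hz, hzb]; ring
    rw [Complex.ofReal_pow, h2, h3]
    module
  have h4 : (η : ℂ) * inner ℂ g g = inner ℂ e k := by
    rw [← inner_smul_right, ← hg', ← hg, inner_sub_right, inner_sub_left, inner_smul_right,
      inner_smul_left]
    have h5 : (inner ℂ (T g) k) = inner ℂ g (T k) := hT.isSymmetric g k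
    have h6 : (starRingEnd ℂ) z = zb := by simp [hz, hzb, sub_eq_add_neg]
    rw [h5, h6]
  rw [← h4, inner_self_eq_norm_sq_to_K]
  simp [← Complex.ofReal_pow]

theorem add_adjoint_le_algebraMap {P : H →L[ℂ] H} {L : ℝ}
    (h : ∀ f : H, 2 * (inner ℂ (P f) f).re ≤ L * ‖f‖ ^ 2) :
    P + P.adjoint ≤ algebraMap ℝ (H →L[ℂ] H) L := by
  rw [← sub_nonneg, ContinuousLinearMap.nonneg_iff_isPositive, ContinuousLinearMap.isPositive_def']
  constructor
  · have h1 : IsSelfAdjoint (P + P.adjoint) := IsSelfAdjoint.add_star_self P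
    exact (IsSelfAdjoint.algebraMap _ (IsSelfAdjoint.all L)).sub h1
  · intro f
    have h1 : (algebraMap ℝ (H →L[ℂ] H) L) f = (L : ℂ) • f := by
      simp [Algebra.algebraMap_eq_smul_one]
    have h2 : (inner ℂ f (P f)).re = (inner ℂ (P f) f).re := inner_re_symm (𝕜 := ℂ) f (P f)
    have h3 : (inner ℂ ((L : ℂ) • f) f).re = L * ‖f‖ ^ 2 := by
      rw [inner_smul_left, inner_self_eq_norm_sq_to_K]
      simp [← Complex.ofReal_pow]
    rw [ContinuousLinearMap.reApplyInnerSelf_apply, sub_apply, h1, add_apply, inner_sub_left,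
      inner_add_left, ContinuousLinearMap.adjoint_inner_left]
    simp only [RCLike.re_to_complex, Complex.sub_re, Complex.add_re, h2, h3]
    linarith [h f]

end SpectralMeasure

/-! ### Recovering a measure from its Poisson integrals -/

/-- The substitution `τ = t + η s` moves `η` from the kernel into the continuous function `f`, which
permits dominated convergence as `η ↓ 0`. -/
theorem integral_mul_poissonKernel_eq (f : ℝ → ℝ) (t : ℝ) {η : ℝ} (hη : 0 < η) :
    ∫ τ, f τ * (1 / Real.pi * (η / ((t - τ) ^ 2 + η ^ 2))) =
      ∫ s, f (t + η * s) * (1 / Real.pi * (1 + s ^ 2)⁻¹) := by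
  set G : ℝ → ℝ := fun τ => f τ * (1 / Real.pi * (η / ((t - τ) ^ 2 + η ^ 2))) with hG
  have h1 : ∫ s, G (t + η * s) = η⁻¹ * ∫ τ, G τ := by
    rw [Measure.integral_comp_mul_left (fun x => G (t + x)) η, integral_add_left_eq_self,
      abs_of_pos (inv_pos.mpr hη), smul_eq_mul]
  have h2 : ∫ τ, G τ = η * ∫ s, G (t + η * s) := by
    rw [h1, mul_inv_cancel_left₀ hη.ne']
  rw [h2, ← integral_const_mul]
  congr 1
  ext s
  have h3 : (1 + s ^ 2) ≠ 0 := by positivity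
  have h4 : (t - (t + η * s)) ^ 2 + η ^ 2 = η ^ 2 * (1 + s ^ 2) := by ring
  simp only [hG, h4]
  field_simp

/-- Convolutions of a probability measure with the Poisson kernels converge vaguely to it. -/
theorem tendsto_integral_mul_poisson (ρ : Measure ℝ) [IsProbabilityMeasure ρ] {f : ℝ → ℝ}
    (hf : Continuous f) (hfc : HasCompactSupport f) :
    Tendsto (fun η : ℝ => ∫ τ, f τ * (1 / Real.pi * ∫ t, η / ((t - τ) ^ 2 + η ^ 2) ∂ρ))
      (𝓝[>] 0) (𝓝 (∫ t, f t ∂ρ)) := by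
  obtain ⟨M, hM⟩ := hf.bounded_above_of_compact_support hfc
  have hM0 : 0 ≤ M := (norm_nonneg _).trans (hM 0)
  have hk : Integrable (fun s : ℝ => 1 / Real.pi * (1 + s ^ 2)⁻¹) :=
    integrable_inv_one_add_sq.const_mul _
  have hlim : Tendsto (fun η : ℝ => ∫ p : ℝ × ℝ,
      f (p.1 + η * p.2) * (1 / Real.pi * (1 + p.2 ^ 2)⁻¹) ∂(ρ.prod volume)) (𝓝[>] 0)
      (𝓝 (∫ p : ℝ × ℝ, f p.1 * (1 / Real.pi * (1 + p.2 ^ 2)⁻¹) ∂(ρ.prod volume))) := by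
    refine tendsto_integral_filter_of_dominated_convergence
      (fun p => M * (1 / Real.pi * (1 + p.2 ^ 2)⁻¹)) ?_ ?_ ?_ ?_
    · refine Eventually.of_forall fun η => Continuous.aestronglyMeasurable ?_
      have : ∀ p : ℝ × ℝ, 1 + p.2 ^ 2 ≠ 0 := fun p => by positivity
      fun_prop (disch := assumption)
    · refine Eventually.of_forall fun η => Eventually.of_forall fun p => ?_
      have : 0 ≤ 1 / Real.pi * (1 + p.2 ^ 2)⁻¹ := by positivity
      rw [norm_mul, Real.norm_of_nonneg this]
      exact mul_le_mul_of_nonneg_right (hM _) this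
    · exact (hk.comp_snd ρ).const_mul M
    · refine Eventually.of_forall fun p => Tendsto.mul_const _ ?_
      have h : Continuous fun η : ℝ => f (p.1 + η * p.2) := by fun_prop
      simpa using (h.tendsto 0).mono_left nhdsWithin_le_nhds
  rw [integral_prod_mul (fun t => f t) (fun s : ℝ => 1 / Real.pi * (1 + s ^ 2)⁻¹),
    integral_const_mul, integral_univ_inv_one_add_sq, one_div_mul_cancel Real.pi_ne_zero,
    mul_one] at hlim
  refine hlim.congr' ?_
  filter_upwards [self_mem_nhdsWithin] with η hη
  rw [Set.mem_Ioi] at hη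
  have hint : Integrable (fun p : ℝ × ℝ => f (p.1 + η * p.2) * (1 / Real.pi * (1 + p.2 ^ 2)⁻¹))
      (ρ.prod volume) := by
    refine ((hk.comp_snd ρ).bdd_mul (c := M) (Continuous.aestronglyMeasurable ?_) ?_)
    · fun_prop
    · exact Eventually.of_forall fun p => hM _
  rw [integral_prod _ hint]
  simp_rw [← integral_mul_poissonKernel_eq f _ hη]
  have hpos (p : ℝ × ℝ) : (p.2 - p.1) ^ 2 + η ^ 2 ≠ 0 := by positivity
  have hint2 : Integrable (fun p : ℝ × ℝ =>
      f p.1 * (1 / Real.pi * (η / ((p.2 - p.1) ^ 2 + η ^ 2)))) (volume.prod ρ) := by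
    refine ((hf.integrable_of_hasCompactSupport hfc).comp_fst ρ).mul_bdd
      (c := 1 / Real.pi * (1 / η)) (Continuous.aestronglyMeasurable ?_) ?_
    · fun_prop (disch := assumption)
    · refine Eventually.of_forall fun p => ?_
      have : 0 ≤ η / ((p.2 - p.1) ^ 2 + η ^ 2) := by positivity
      rw [Real.norm_of_nonneg (by positivity)]
      refine mul_le_mul_of_nonneg_left ?_ (by positivity)
      rw [div_le_div_iff₀ (by positivity) hη]
      nlinarith [sq_nonneg (p.2 - p.1)]
  rw [integral_integral_swap (f := fun t τ => f τ * (1 / Real.pi * (η / ((t - τ) ^ 2 + η ^ 2))))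
    (by exact hint2.swap)]
  congr 1
  ext τ
  rw [integral_const_mul, integral_const_mul]

/-! ### The least positive root of `φ_J`, in the variable `u = w / 2` -/

section PowerSeriesRoot

theorem summable_pow_succ_mul {c : ℕ → ℝ} (h0 : ∀ j, 0 ≤ c j) (h1 : ∀ j, c j ≤ 1) {u : ℝ}
    (hu0 : 0 ≤ u) (hu1 : u < 1) : Summable fun j => u ^ (j + 1) * c j := by
  refine Summable.of_nonneg_of_le (fun j => mul_nonneg (by positivity) (h0 j)) (fun j => ?_)
    ((summable_nat_add_iff 1).mpr (summable_geometric_of_lt_one hu0 hu1))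
  exact mul_le_of_le_one_right (by positivity) (h1 j)

theorem mul_one_add_tsum_strictMono {c : ℕ → ℝ} (h0 : ∀ j, 0 ≤ c j) {u u' : ℝ} (hu0 : 0 ≤ u)
    (huu' : u < u') (hs : Summable fun j => u' ^ (j + 1) * c j) :
    u * (1 + ∑' j, u ^ (j + 1) * c j) < u' * (1 + ∑' j, u' ^ (j + 1) * c j) := by
  have hle (j : ℕ) : u ^ (j + 1) * c j ≤ u' ^ (j + 1) * c j :=
    mul_le_mul_of_nonneg_right (pow_le_pow_left₀ hu0 huu'.le _) (h0 j)
  have hnn (j : ℕ) : 0 ≤ u ^ (j + 1) * c j := mul_nonneg (by positivity) (h0 j)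
  have hs' := Summable.of_nonneg_of_le hnn hle hs
  have h1 := hs'.tsum_le_tsum hle hs
  have h2 : 0 ≤ ∑' j, u ^ (j + 1) * c j := tsum_nonneg hnn
  nlinarith

theorem exists_root_mul_one_add_tsum {c : ℕ → ℝ} (h0 : ∀ j, 0 ≤ c j) (h1 : ∀ j, c j ≤ 1) :
    ∃ u : ℝ, 0 < u ∧ (Summable fun j => u ^ (j + 1) * c j) ∧
      u * (1 + ∑' j, u ^ (j + 1) * c j) = 1 := by
  by_cases hc : ∀ j, c j = 0
  · exact ⟨1, one_pos, by simp [hc, summable_zero], by simp [hc]⟩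
  push Not at hc
  obtain ⟨k, hk⟩ := hc
  have hk : 0 < c k := (h0 k).lt_of_ne' hk
  have hcont : Continuous fun u : ℝ => u * (1 + u ^ (k + 1) * c k) := by fun_prop
  -- One positive coefficient suffices: at `u = 1` this partial sum is `1 + c k > 1`, so it still
  -- exceeds 1 at some `u < 1`, where the full series converges.
  have hev : ∀ᶠ u in 𝓝[<] (1 : ℝ), 1 < u * (1 + u ^ (k + 1) * c k) :=
    ((hcont.tendsto 1).mono_left nhdsWithin_le_nhds).eventually_const_lt (by simpa using hk)
  obtain ⟨u, hu, hu0, hu1⟩ :=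
    (hev.and (Ioo_mem_nhdsLT (zero_lt_one' ℝ))).exists
  have hs := summable_pow_succ_mul h0 h1 hu0.le hu1
  have hF : ContinuousOn (fun x : ℝ => x * (1 + ∑' j, x ^ (j + 1) * c j)) (Set.Icc 0 u) := by
    refine continuousOn_id.mul (continuousOn_const.add ?_)
    refine continuousOn_tsum (fun j => by fun_prop) hs fun j x hx => ?_
    rw [Real.norm_of_nonneg (mul_nonneg (pow_nonneg hx.1 _) (h0 j))]
    exact mul_le_mul_of_nonneg_right (pow_le_pow_left₀ hx.1 hx.2 _) (h0 j)
  have hFu : 1 ≤ u * (1 + ∑' j, u ^ (j + 1) * c j) := by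
    refine hu.le.trans (mul_le_mul_of_nonneg_left ?_ hu0.le)
    have := hs.le_tsum k (fun j _ => mul_nonneg (by positivity) (h0 j))
    linarith
  obtain ⟨x, hx, hx1⟩ := intermediate_value_Icc hu0.le hF ⟨by simp, hFu⟩
  have hx0 : 0 < x := by
    refine hx.1.lt_of_ne' ?_
    rintro rfl
    simp at hx1
  exact ⟨x, hx0, summable_pow_succ_mul h0 h1 hx.1 (hx.2.trans_lt hu1), hx1⟩

/-- The point `u = 1 / 2` is `w = 1`, where the series is dominated by `∑ 2 ^ -(j + 1) = 1`. -/
theorem half_mul_one_add_tsum_le {c : ℕ → ℝ} (h0 : ∀ j, 0 ≤ c j) (h1 : ∀ j, c j ≤ 1) :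
    (1 / 2 : ℝ) * (1 + ∑' j, (1 / 2 : ℝ) ^ (j + 1) * c j) ≤ 1 ∧
      ((∃ j, c j < 1) → (1 / 2 : ℝ) * (1 + ∑' j, (1 / 2 : ℝ) ^ (j + 1) * c j) < 1) := by
  have hs := summable_pow_succ_mul h0 h1 (u := 1 / 2) (by norm_num) (by norm_num)
  have hg : HasSum (fun j : ℕ => (1 / 2 : ℝ) ^ (j + 1)) 1 := by
    have := hasSum_geometric_two.mul_left (1 / 2 : ℝ)
    simpa only [pow_succ', one_div, inv_mul_cancel₀ (two_ne_zero' ℝ)] using this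
  have hle (j : ℕ) : (1 / 2 : ℝ) ^ (j + 1) * c j ≤ (1 / 2 : ℝ) ^ (j + 1) :=
    mul_le_of_le_one_right (by positivity) (h1 j)
  constructor
  · have := hs.tsum_le_tsum hle hg.summable
    rw [hg.tsum_eq] at this
    linarith
  · rintro ⟨k, hk⟩
    have := hs.tsum_lt_tsum hle (i := k) (mul_lt_of_lt_one_right (by positivity) hk) hg.summable
    rw [hg.tsum_eq] at this
    linarith

end PowerSeriesRoot

section Phi
variable {N : ℕ} (S : Matrix (Fin N) (Fin N) ℝ)

theorem normRatio_nonneg (j : ℕ) : 0 ≤ normRatio S j := by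
  unfold normRatio; positivity

theorem normRatio_le_one {j : ℕ} (hj : 1 ≤ j) : normRatio S j ≤ 1 :=
  div_le_one_of_le₀ (norm_pow_le' S hj) (by positivity)

open Classical in
/-- The coefficient of `(w / 2) ^ (j + 1)` in the series of `phi S J w`. -/
noncomputable def phiCoeff (J : ℕ∞) (j : ℕ) : ℝ :=
  if ((j + 1 : ℕ) : ℕ∞) ≤ J then normRatio S (j + 1) else 1

theorem phiTerm_succ (J : ℕ∞) (w : ℝ) (j : ℕ) :
    phiTerm S J w (j + 1) = (w / 2) ^ (j + 1) * phiCoeff S J j := rfl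

theorem phiCoeff_nonneg (J : ℕ∞) (j : ℕ) : 0 ≤ phiCoeff S J j := by
  unfold phiCoeff
  split_ifs
  exacts [normRatio_nonneg S _, zero_le_one]

theorem phiCoeff_le_one (J : ℕ∞) (j : ℕ) : phiCoeff S J j ≤ 1 := by
  unfold phiCoeff
  split_ifs
  exacts [normRatio_le_one S (by simp), le_rfl]

/-- The only relation between the coefficients and `S` that the support bound needs; it treats all
`J` at once. -/
theorem normRatio_le_phiCoeff (J : ℕ∞) (j : ℕ) : normRatio S (j + 1) ≤ phiCoeff S J j := by
  unfold phiCoeff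
  split_ifs
  exacts [le_rfl, normRatio_le_one S (by simp)]

theorem mem_phiPosRoots_iff (J : ℕ∞) (w : ℝ) : w ∈ phiPosRoots S J ↔
    0 < w ∧ (Summable fun j => (w / 2) ^ (j + 1) * phiCoeff S J j) ∧
      w / 2 * (1 + ∑' j, (w / 2) ^ (j + 1) * phiCoeff S J j) = 1 := by
  simp only [phiPosRoots, phi, phiTerm_succ, Set.mem_ofPred_eq, sub_eq_zero]
  exact and_congr_right fun _ => and_congr_right fun _ => eq_comm

theorem exists_isLeast_phiPosRoots (J : ℕ∞) : ∃ w, IsLeast (phiPosRoots S J) w := by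
  obtain ⟨u, hu0, hs, hu⟩ :=
    exists_root_mul_one_add_tsum (phiCoeff_nonneg S J) (phiCoeff_le_one S J)
  refine ⟨2 * u, ?_, fun w hw => ?_⟩
  · rw [mem_phiPosRoots_iff, mul_div_cancel_left₀ _ two_ne_zero]
    exact ⟨by positivity, hs, hu⟩
  · rw [mem_phiPosRoots_iff] at hw
    obtain ⟨hw0, -, hw⟩ := hw
    by_contra! hlt
    have := mul_one_add_tsum_strictMono (phiCoeff_nonneg S J) (u := w / 2) (by positivity)
      (by linarith) hs
    linarith

theorem one_le_of_mem_phiPosRoots {J : ℕ∞} {w : ℝ} (hw : w ∈ phiPosRoots S J) : 1 ≤ w := by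
  rw [mem_phiPosRoots_iff] at hw
  obtain ⟨hw0, -, hw⟩ := hw
  by_contra! hlt
  have := mul_one_add_tsum_strictMono (phiCoeff_nonneg S J) (u := w / 2) (u' := 1 / 2)
    (by positivity) (by linarith) (summable_pow_succ_mul (phiCoeff_nonneg S J)
      (phiCoeff_le_one S J) (by norm_num) (by norm_num))
  linarith [(half_mul_one_add_tsum_le (phiCoeff_nonneg S J) (phiCoeff_le_one S J)).1]

theorem one_lt_of_mem_phiPosRoots {J : ℕ∞} {w : ℝ} (hw : w ∈ phiPosRoots S J)
    (hJ : ∃ j : ℕ, 1 ≤ j ∧ (j : ℕ∞) ≤ J ∧ normRatio S j < 1) : 1 < w := by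
  refine (one_le_of_mem_phiPosRoots S hw).lt_of_ne ?_
  rintro rfl
  rw [mem_phiPosRoots_iff] at hw
  obtain ⟨j, hj1, hjJ, hj⟩ := hJ
  obtain ⟨k, rfl⟩ := Nat.exists_eq_succ_of_ne_zero (by omega : j ≠ 0)
  refine ((half_mul_one_add_tsum_le (phiCoeff_nonneg S J) (phiCoeff_le_one S J)).2 ⟨k, ?_⟩).ne
    hw.2.2
  unfold phiCoeff
  rwa [if_pos hjJ]

end Phi

/-! ### The supersolution from the Neumann series -/

theorem Matrix.sum_row_le_linfty_opNorm {N : ℕ} (M : Matrix (Fin N) (Fin N) ℝ) (x : Fin N) :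
    ∑ y, M x y ≤ ‖M‖ := by
  rw [matrix_norm_eq_maxRowSum]
  exact (Finset.sum_le_sum fun y _ => le_abs_self _).trans
    (le_ciSup (f := fun x => ∑ y, |M x y|) (Set.finite_range _).bddAbove x)

theorem Matrix.pow_nonneg_entries {N : ℕ} {S : Matrix (Fin N) (Fin N) ℝ} (hS : ∀ x y, 0 ≤ S x y)
    (j : ℕ) : ∀ x y, 0 ≤ (S ^ j) x y := by
  induction j with
  | zero => intro x y; rw [pow_zero, Matrix.one_apply]; split_ifs <;> norm_num
  | succ j ih =>
    intro x y
    rw [pow_succ, Matrix.mul_apply]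
    exact Finset.sum_nonneg fun k _ => mul_nonneg (ih _ _) (hS _ _)

/-- The Neumann series `u ∑ j, (u S / ‖S‖) ^ j 1`, suitably scaled, is a positive supersolution of
the quadratic vector equation at the spectral parameter `√‖S‖ / u`. -/
theorem exists_supersolution {N : ℕ} {S : Matrix (Fin N) (Fin N) ℝ} (hS : ∀ x y, 0 ≤ S x y)
    (hS0 : S ≠ 0) {c : ℕ → ℝ} (hc : ∀ j, normRatio S (j + 1) ≤ c j) {u : ℝ} (hu : 0 < u)
    (hs : Summable fun j => u ^ (j + 1) * c j) (hu1 : u * (1 + ∑' j, u ^ (j + 1) * c j) = 1) :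
    ∃ v : Fin N → ℝ, (∀ x, 0 < v x) ∧ ∀ x, 1 / v x + ∑ y, S x y * v y ≤ √‖S‖ / u := by
  have hn : 0 < ‖S‖ := norm_pos_iff.mpr hS0
  set a : ℕ → Fin N → ℝ := fun j x => u ^ (j + 1) * ((∑ y, (S ^ j) x y) / ‖S‖ ^ j) with ha
  have ha0 (j x) : 0 ≤ a j x := by
    have := Finset.sum_nonneg fun y (_ : y ∈ Finset.univ) => Matrix.pow_nonneg_entries hS j x y
    simp only [ha]; positivity
  have hac (j x) : a (j + 1) x ≤ u * (u ^ (j + 1) * c j) := by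
    have h1 : (∑ y, (S ^ (j + 1)) x y) / ‖S‖ ^ (j + 1) ≤ c j :=
      (div_le_div_of_nonneg_right (Matrix.sum_row_le_linfty_opNorm _ x) (by positivity)).trans
        (hc j)
    calc a (j + 1) x ≤ u ^ (j + 1 + 1) * c j := mul_le_mul_of_nonneg_left h1 (by positivity)
      _ = _ := by ring
  have hsum1 (x) : Summable fun j => a (j + 1) x :=
    Summable.of_nonneg_of_le (fun j => ha0 _ x) (fun j => hac j x) (hs.mul_left u)
  have hsum (x) : Summable fun j => a j x := (summable_nat_add_iff 1).mp (hsum1 x)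
  set V : Fin N → ℝ := fun x => ∑' j, a j x with hV
  have hazero (x) : a 0 x = u := by simp [ha, Matrix.one_apply]
  have hVx (x) : V x = u + ∑' j, a (j + 1) x := by
    simp only [hV]; rw [(hsum x).tsum_eq_zero_add, hazero]
  have huV (x) : u ≤ V x := by
    have : 0 ≤ ∑' j, a (j + 1) x := tsum_nonneg fun j => ha0 _ x
    rw [hVx]; linarith
  -- The root equation for `u` enters here: `u + ∑ u * (u ^ (j + 1) * c j) = 1`.
  have hV1 (x) : V x ≤ 1 := by
    have := (hsum1 x).tsum_le_tsum (fun j => hac j x) (hs.mul_left u)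
    rw [tsum_mul_left] at this
    rw [hVx]; linarith
  -- Applying `S` shifts the Neumann series by one index.
  have hSV (x) : ∑ y, S x y * V y = ‖S‖ / u * (V x - u) := by
    have h1 (j) : ∑ y, S x y * a j y = ‖S‖ / u * a (j + 1) x := by
      have h2 : ∑ y, (S ^ (j + 1)) x y = ∑ y, S x y * ∑ k, (S ^ j) y k := by
        simp_rw [pow_succ', Matrix.mul_apply, Finset.mul_sum]
        exact Finset.sum_comm
      simp only [ha]
      rw [h2, Finset.sum_div, Finset.mul_sum, Finset.mul_sum]
      refine Finset.sum_congr rfl fun y _ => ?_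
      field_simp
      ring
    rw [hVx, add_sub_cancel_left, ← tsum_mul_left]
    simp only [hV, ← tsum_mul_left, ← h1]
    exact (Summable.tsum_finsetSum fun y _ => (hsum y).mul_left _).symm
  have hq : 0 < √‖S‖ := Real.sqrt_pos.mpr hn
  refine ⟨fun x => V x / √‖S‖, fun x => div_pos (hu.trans_le (huV x)) hq, fun x => ?_⟩
  have hVpos := hu.trans_le (huV x)
  simp_rw [← mul_div_assoc]
  rw [← Finset.sum_div, hSV]
  have hsq : ‖S‖ = √‖S‖ * √‖S‖ := (Real.mul_self_sqrt hn.le).symm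
  have h1 : ‖S‖ / u * (V x - u) / √‖S‖ = √‖S‖ * (V x / u - 1) := by
    nth_rewrite 1 [hsq]
    field_simp
  -- With `u ≤ V ≤ 1` this rearranges to `1 / V + V / u - 1 ≤ 1 / u`.
  have h2 : (1 - V x) / V x ≤ (1 - V x) / u :=
    div_le_div_of_nonneg_left (by linarith [hV1 x]) hu (huV x)
  have h3 : (1 - V x) / V x = 1 / V x - 1 := by field_simp
  have h4 : (1 - V x) / u = 1 / u - V x / u := by ring
  rw [h1, one_div_div]
  calc √‖S‖ / V x + √‖S‖ * (V x / u - 1) = √‖S‖ * (1 / V x + (V x / u - 1)) := by ring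
    _ ≤ √‖S‖ * (1 / u) := mul_le_mul_of_nonneg_left (by linarith) hq.le
    _ = _ := by ring

/-! ### Uniqueness for the quadratic vector equation -/

section Uniqueness
variable {N : ℕ} {S : Matrix (Fin N) (Fin N) ℝ} {z : ℂ}

theorem IsQVESolution.im_eq {m : Fin N → ℂ} (hm : IsQVESolution S z m) (x : Fin N) :
    (m x).im = Complex.normSq (m x) * (z.im + ∑ y, S x y * (m y).im) := by
  obtain ⟨hpos, heq⟩ := hm x
  have hne : m x ≠ 0 := fun h => by simp [h] at hpos
  have h := congrArg Complex.im heq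
  have h1 : (-1 / m x).im = (m x).im / Complex.normSq (m x) := by
    rw [neg_div, one_div, Complex.neg_im, Complex.inv_im]; ring
  rw [h1] at h
  have h2 : Complex.normSq (m x) ≠ 0 := by simpa using hne
  rw [div_eq_iff h2] at h
  rw [h, Complex.add_im, Complex.im_sum]
  simp [mul_comm]

/-- At an index where `‖m - m'‖ / √(Im m * Im m')` is maximal, the difference of the two equations
and Cauchy–Schwarz bound this maximum by itself times a factor. By `IsQVESolution.im_eq` and `0 <
z.im` the factor is less than 1, so the maximum is 0. -/
theorem IsQVESolution.unique (hS : ∀ x y, 0 ≤ S x y) (hz : 0 < z.im) {m m' : Fin N → ℂ}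
    (hm : IsQVESolution S z m) (hm' : IsQVESolution S z m') : m = m' := by
  rcases isEmpty_or_nonempty (Fin N) with hE | hE
  · exact Subsingleton.elim _ _
  set e : Fin N → ℝ := fun x => ‖m x - m' x‖ / (√(m x).im * √(m' x).im) with he
  have hq (x) : 0 < √(m x).im * √(m' x).im :=
    mul_pos (Real.sqrt_pos.mpr (hm x).1) (Real.sqrt_pos.mpr (hm' x).1)
  have hd (x) : ‖m x - m' x‖ = e x * (√(m x).im * √(m' x).im) :=
    (div_mul_cancel₀ _ (hq x).ne').symm
  obtain ⟨x, hx⟩ := Finite.exists_max e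
  have he0 : 0 ≤ e x := by simp only [he]; positivity
  suffices h : e x = 0 by
    ext y
    have h1 : e y ≤ 0 := h ▸ hx y
    have h2 : ‖m y - m' y‖ ≤ 0 := by
      rw [hd]; exact mul_nonpos_of_nonpos_of_nonneg h1 (hq y).le
    exact sub_eq_zero.mp (norm_le_zero_iff.mp h2)
  have hne : m x ≠ 0 := fun h => by simpa [h] using (hm x).1
  have hne' : m' x ≠ 0 := fun h => by simpa [h] using (hm' x).1
  have hdiff : m x - m' x = m x * m' x * ∑ y, (S x y : ℂ) * (m y - m' y) := by
    have h1 := (hm x).2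
    have h2 := (hm' x).2
    have h3 : ∑ y, (S x y : ℂ) * (m y - m' y) = -1 / m x - -1 / m' x := by
      rw [h1, h2]
      simp only [mul_sub, Finset.sum_sub_distrib]
      ring
    rw [h3]
    field_simp
    ring
  set A := ∑ y, S x y * (m y).im
  set A' := ∑ y, S x y * (m' y).im
  have hA : 0 ≤ A := Finset.sum_nonneg fun y _ => mul_nonneg (hS x y) (hm y).1.le
  have hA' : 0 ≤ A' := Finset.sum_nonneg fun y _ => mul_nonneg (hS x y) (hm' y).1.le
  have hCS : ∑ y, S x y * (√(m y).im * √(m' y).im) ≤ √A * √A' := by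
    have := Real.sum_sqrt_mul_sqrt_le (Finset.univ) (f := fun y => S x y * (m y).im)
      (g := fun y => S x y * (m' y).im) (fun y => mul_nonneg (hS x y) (hm y).1.le)
      (fun y => mul_nonneg (hS x y) (hm' y).1.le)
    refine le_trans (le_of_eq (Finset.sum_congr rfl fun y _ => ?_)) this
    rw [Real.sqrt_mul (hS x y), Real.sqrt_mul (hS x y)]
    nth_rewrite 1 [← Real.mul_self_sqrt (hS x y)]
    ring
  have hbound : ‖m x - m' x‖ ≤ ‖m x‖ * ‖m' x‖ * (e x * (√A * √A')) := by
    rw [hdiff, norm_mul, norm_mul]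
    refine mul_le_mul_of_nonneg_left ?_ (by positivity)
    refine (norm_sum_le _ _).trans ?_
    calc ∑ y, ‖(S x y : ℂ) * (m y - m' y)‖
        ≤ ∑ y, e x * (S x y * (√(m y).im * √(m' y).im)) := by
          refine Finset.sum_le_sum fun y _ => ?_
          rw [norm_mul, Complex.norm_real, Real.norm_of_nonneg (hS x y), hd, mul_left_comm (e x)]
          exact mul_le_mul_of_nonneg_left
            (mul_le_mul_of_nonneg_right (hx y) (hq y).le) (hS x y)
      _ = e x * ∑ y, S x y * (√(m y).im * √(m' y).im) := by rw [Finset.mul_sum]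
      _ ≤ _ := mul_le_mul_of_nonneg_left hCS he0
  have hlt {k : Fin N → ℂ} (hk : IsQVESolution S z k) (hk0 : k x ≠ 0) :
      ‖k x‖ * √(∑ y, S x y * (k y).im) < √(k x).im := by
    have h1 := hk.im_eq x
    have h2 : 0 < Complex.normSq (k x) := by simpa using hk0
    have h3 : ‖k x‖ = √(Complex.normSq (k x)) := rfl
    rw [h3, ← Real.sqrt_mul h2.le]
    refine Real.sqrt_lt_sqrt (mul_nonneg h2.le
      (Finset.sum_nonneg fun y _ => mul_nonneg (hS x y) (hk y).1.le)) ?_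
    nlinarith [mul_pos h2 hz]
  have hprod := mul_lt_mul'' (hlt hm hne) (hlt hm' hne') (by positivity) (by positivity)
  by_contra hex
  have hex' : 0 < e x := he0.lt_of_ne' hex
  rw [hd] at hbound
  have := mul_lt_mul_of_pos_left hprod hex'
  have h5 : ‖m x‖ * ‖m' x‖ * (e x * (√A * √A')) = e x * (‖m x‖ * √A * (‖m' x‖ * √A')) := by ring
  linarith

end Uniqueness

/-! ### Weighted composition operators on `ℓ²` and their adjoints -/

section WeightedComp

/-- The Hilbert space of square summable complex families. -/
noncomputable abbrev SeqSpace (ι : Type*) : Type _ := ↥(lp (fun _ : ι => ℂ) 2)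

variable {ι κ : Type*}

theorem SeqSpace.summable_norm_sq (f : SeqSpace ι) : Summable fun i => ‖f i‖ ^ 2 := by
  have := (lp.memℓp f).summable (by norm_num)
  simpa using this

theorem SeqSpace.norm_sq_eq_tsum (f : SeqSpace ι) : ‖f‖ ^ 2 = ∑' i, ‖f i‖ ^ 2 := by
  have := lp.norm_rpow_eq_tsum (p := 2) (by norm_num) f
  simpa using this

theorem memℓp_two_of_summable {f : ι → ℂ} (hf : Summable fun i => ‖f i‖ ^ 2) : Memℓp f 2 :=
  memℓp_gen (by simpa using hf)

/-- The operator `f ↦ b * (f ∘ i)` on square summable sequences, for injective `i` and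
bounded `b`. -/
theorem SeqSpace.exists_weightedComp (i : κ → ι) (hi : Function.Injective i) (b : κ → ℝ) (B : ℝ)
    (hb : ∀ w, |b w| ≤ B) : ∃ A : SeqSpace ι →L[ℂ] SeqSpace κ, ∀ f w, A f w = b w * f (i w) := by
  have hsum (f : SeqSpace ι) : Summable fun w => ‖f (i w)‖ ^ 2 :=
    (SeqSpace.summable_norm_sq f).comp_injective hi
  have hle (f : SeqSpace ι) (w) : ‖(b w : ℂ) * f (i w)‖ ^ 2 ≤ B ^ 2 * ‖f (i w)‖ ^ 2 := by
    rw [norm_mul, mul_pow, Complex.norm_real, Real.norm_eq_abs]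
    exact mul_le_mul_of_nonneg_right (pow_le_pow_left₀ (abs_nonneg _) (hb w) 2) (by positivity)
  have hs (f : SeqSpace ι) : Summable fun w => ‖(b w : ℂ) * f (i w)‖ ^ 2 :=
    Summable.of_nonneg_of_le (fun w => by positivity) (hle f) ((hsum f).mul_left _)
  refine ⟨LinearMap.mkContinuous
    { toFun := fun f => ⟨fun w => (b w : ℂ) * f (i w), memℓp_two_of_summable (hs f)⟩
      map_add' := fun f g => by ext w; exact mul_add _ _ _
      map_smul' := fun c f => by ext w; exact mul_left_comm _ _ _ } |B| fun f => ?_, fun f w => rfl⟩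
  refine abs_le_of_sq_le_sq' ?_ (by positivity) |>.2
  rw [mul_pow, sq_abs, SeqSpace.norm_sq_eq_tsum, SeqSpace.norm_sq_eq_tsum]
  calc ∑' w, ‖(b w : ℂ) * f (i w)‖ ^ 2 ≤ ∑' w, B ^ 2 * ‖f (i w)‖ ^ 2 :=
        (hs f).tsum_le_tsum (hle f) ((hsum f).mul_left _)
    _ = B ^ 2 * ∑' w, ‖f (i w)‖ ^ 2 := tsum_mul_left
    _ ≤ _ := mul_le_mul_of_nonneg_left
        (tsum_comp_le_tsum_of_inj (SeqSpace.summable_norm_sq f) (fun _ => sq_nonneg _) hi) (by positivity)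

variable [DecidableEq ι]

theorem SeqSpace.apply_eq_inner (f : SeqSpace ι) (l : ι) :
    f l = inner ℂ (lp.single 2 l (1 : ℂ) : SeqSpace ι) f := by
  rw [lp.inner_single_left]; simp

theorem SeqSpace.adjoint_apply_eq_inner (A : SeqSpace ι →L[ℂ] SeqSpace κ) (f : SeqSpace κ)
    (l : ι) : A.adjoint f l = inner ℂ (A (lp.single 2 l (1 : ℂ))) f := by
  rw [SeqSpace.apply_eq_inner, ContinuousLinearMap.adjoint_inner_right]

variable {i : κ → ι} {b : κ → ℝ} {A : SeqSpace ι →L[ℂ] SeqSpace κ}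

theorem SeqSpace.adjoint_weightedComp_apply [DecidableEq κ] (hi : Function.Injective i)
    (hA : ∀ f w, A f w = b w * f (i w)) (f : SeqSpace κ) (w : κ) :
    A.adjoint f (i w) = b w * f w := by
  have h : A (lp.single 2 (i w) (1 : ℂ)) = lp.single 2 w (b w : ℂ) := by
    ext v
    rw [hA, lp.single_apply, lp.single_apply]
    by_cases h : v = w
    · subst h; simp
    · simp [h, hi.ne h]
  rw [SeqSpace.adjoint_apply_eq_inner, h, lp.inner_single_left]
  simp [mul_comm]

theorem SeqSpace.adjoint_weightedComp_apply_of_notMem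
    (hA : ∀ f w, A f w = b w * f (i w)) (f : SeqSpace κ) {l : ι} (hl : l ∉ Set.range i) :
    A.adjoint f l = 0 := by
  have h : A (lp.single 2 l (1 : ℂ)) = 0 := by
    ext v
    rw [hA, lp.single_apply_ne]
    · simp
    · exact fun h => hl ⟨v, h⟩
  rw [SeqSpace.adjoint_apply_eq_inner, h, inner_zero_left]

end WeightedComp

/-! ### The tree operator and its upper bound -/

section Tree
variable {N : ℕ} (S : Matrix (Fin N) (Fin N) ℝ)

/-- The weight of the edge from `w` to its child `y :: w` in the tree of lists; the empty list is
an isolated vertex. -/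
noncomputable def edgeWeight (y : Fin N) : List (Fin N) → ℝ
  | [] => 0
  | x :: _ => √(S x y)

@[simp] theorem edgeWeight_nil (y : Fin N) : edgeWeight S y [] = 0 := rfl

@[simp] theorem edgeWeight_cons (y x : Fin N) (w : List (Fin N)) :
    edgeWeight S y (x :: w) = √(S x y) := rfl

/-- `P` collects the values at the children and its adjoint passes the value of the parent down, so
`P + P.adjoint` is the weighted adjacency operator. -/
theorem exists_treeShift : ∃ P : SeqSpace (List (Fin N)) →L[ℂ] SeqSpace (List (Fin N)),
    (∀ f w, P f w = ∑ y, (edgeWeight S y w : ℂ) * f (y :: w)) ∧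
    (∀ f, P.adjoint f [] = 0) ∧
    ∀ f y w, P.adjoint f (y :: w) = edgeWeight S y w * f w := by
  have hinj (y : Fin N) : Function.Injective (List.cons y) := List.cons_injective
  have hb (y : Fin N) (w : List (Fin N)) : |edgeWeight S y w| ≤ ∑ x, √(S x y) := by
    cases w with
    | nil => simpa using Finset.sum_nonneg fun x _ => Real.sqrt_nonneg _
    | cons x w =>
      rw [edgeWeight_cons, abs_of_nonneg (Real.sqrt_nonneg _)]
      exact Finset.single_le_sum (f := fun x => √(S x y)) (fun x _ => Real.sqrt_nonneg _)
        (Finset.mem_univ x)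
  choose A hA using fun y => SeqSpace.exists_weightedComp _ (hinj y) _ _ (hb y)
  have hsum (B : Fin N → SeqSpace (List (Fin N)) →L[ℂ] SeqSpace (List (Fin N)))
      (f : SeqSpace (List (Fin N))) (w : List (Fin N)) :
      (∑ y, B y) f w = ∑ y, B y f w := by
    rw [sum_apply, lp.coeFn_sum, Finset.sum_apply]
  refine ⟨∑ y, A y, fun f w => ?_, fun f => ?_, fun f y w => ?_⟩
  · rw [hsum]; simp_rw [hA]
  · rw [map_sum, hsum]
    exact Finset.sum_eq_zero fun y _ =>
      SeqSpace.adjoint_weightedComp_apply_of_notMem (hA y) f (by simp)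
  · rw [map_sum, hsum, Finset.sum_eq_single y]
    · exact SeqSpace.adjoint_weightedComp_apply (hinj y) (hA y) f w
    · intro y' _ hy'
      exact SeqSpace.adjoint_weightedComp_apply_of_notMem (hA y') f (by simp [hy'])
    · simp

theorem tsum_cons_le_tsum {F : List (Fin N) → ℝ} (hF : ∀ l, 0 ≤ F l) (hs : Summable F) :
    (Summable fun w => ∑ y, F (y :: w)) ∧ ∑' w, ∑ y, F (y :: w) ≤ ∑' l, F l := by
  have hi : Function.Injective fun p : List (Fin N) × Fin N => p.2 :: p.1 := by
    rintro ⟨w, y⟩ ⟨w', y'⟩ h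
    simp only [List.cons.injEq] at h
    rw [h.1, h.2]
  have hs' : Summable fun p : List (Fin N) × Fin N => F (p.2 :: p.1) := hs.comp_injective hi
  refine ⟨by simpa only [tsum_fintype] using hs'.prod, ?_⟩
  have := tsum_comp_le_tsum_of_inj hs hF hi
  rw [Function.comp_def, hs'.tsum_prod] at this
  simpa only [tsum_fintype] using this

variable {S}

/-- Schur test for the weighted adjacency operator of the tree. -/
theorem treeShift_add_adjoint_le (hS : ∀ x y, 0 ≤ S x y)
    {P : SeqSpace (List (Fin N)) →L[ℂ] SeqSpace (List (Fin N))}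
    (hP : ∀ f w, P f w = ∑ y, (edgeWeight S y w : ℂ) * f (y :: w))
    {v : Fin N → ℝ} (hv : ∀ x, 0 < v x) {L : ℝ} (hL : 0 ≤ L)
    (hvL : ∀ x, 1 / v x + ∑ y, S x y * v y ≤ L) : P + P.adjoint ≤ algebraMap ℝ _ L := by
  have hform (f : SeqSpace (List (Fin N))) : 2 * (inner ℂ (P f) f).re ≤ L * ‖f‖ ^ 2 := by
    have hsq := SeqSpace.summable_norm_sq f
    -- `k l` weights the edge from `l` to its parent and `d l` the edges to its children. Both
    -- vanish at the isolated vertex `[]`.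
    let k : List (Fin N) → ℝ := fun l => l.head?.elim 0 fun x => 1 / v x
    let d : List (Fin N) → ℝ := fun l => l.head?.elim 0 fun x => ∑ y, S x y * v y
    have hk0 (l) : 0 ≤ k l := by
      cases l with
      | nil => exact le_rfl
      | cons x w => exact (one_div_pos.mpr (hv x)).le
    have hd0 (l) : 0 ≤ d l := by
      cases l with
      | nil => exact le_rfl
      | cons x w => exact Finset.sum_nonneg fun y _ => mul_nonneg (hS x y) (hv y).le
    have hkd (l) : k l + d l ≤ L := by
      cases l with
      | nil => simpa [k, d] using hL
      | cons x w => exact hvL x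
    have hkle (l) : k l * ‖f l‖ ^ 2 ≤ L * ‖f l‖ ^ 2 :=
      mul_le_mul_of_nonneg_right (by linarith [hd0 l, hkd l]) (sq_nonneg _)
    have hdle (l) : d l * ‖f l‖ ^ 2 ≤ L * ‖f l‖ ^ 2 :=
      mul_le_mul_of_nonneg_right (by linarith [hk0 l, hkd l]) (sq_nonneg _)
    have hks : Summable fun l => k l * ‖f l‖ ^ 2 := Summable.of_nonneg_of_le
      (fun l => mul_nonneg (hk0 l) (sq_nonneg _)) hkle (hsq.mul_left L)
    have hds : Summable fun l => d l * ‖f l‖ ^ 2 := Summable.of_nonneg_of_le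
      (fun l => mul_nonneg (hd0 l) (sq_nonneg _)) hdle (hsq.mul_left L)
    obtain ⟨hcs, hcle⟩ := tsum_cons_le_tsum (fun l => mul_nonneg (hk0 l) (sq_nonneg _)) hks
    have hin := Complex.hasSum_re (lp.hasSum_inner (𝕜 := ℂ) (P f) f)
    have hpt (w) : 2 * (inner ℂ (P f w) (f w)).re ≤
        ∑ y, k (y :: w) * ‖f (y :: w)‖ ^ 2 + d w * ‖f w‖ ^ 2 := by
      have h1 : (inner ℂ (P f w) (f w)).re ≤ ∑ y, edgeWeight S y w * ‖f (y :: w)‖ * ‖f w‖ := by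
        rw [hP, sum_inner, Complex.re_sum]
        refine Finset.sum_le_sum fun y _ => (Complex.re_le_norm _).trans ?_
        refine (norm_inner_le_norm _ _).trans_eq ?_
        rw [norm_mul, Complex.norm_real, Real.norm_of_nonneg]
        cases w with
        | nil => exact le_rfl
        | cons x w => exact Real.sqrt_nonneg _
      cases w with
      | nil =>
        have h2 : 0 ≤ ∑ y, k [y] * ‖f [y]‖ ^ 2 :=
          Finset.sum_nonneg fun y _ => mul_nonneg (hk0 _) (sq_nonneg _)
        simp only [edgeWeight_nil, zero_mul, Finset.sum_const_zero] at h1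
        have h3 : d [] * ‖f []‖ ^ 2 = 0 := zero_mul _
        linarith
      | cons x w =>
        have h2 : d (x :: w) * ‖f (x :: w)‖ ^ 2 = ∑ y, S x y * v y * ‖f (x :: w)‖ ^ 2 :=
          Finset.sum_mul _ _ _
        rw [h2, ← Finset.sum_add_distrib]
        refine (mul_le_mul_of_nonneg_left h1 zero_le_two).trans ?_
        rw [Finset.mul_sum]
        refine Finset.sum_le_sum fun y _ => ?_
        have h3 : k (y :: x :: w) = 1 / v y := rfl
        rw [h3, edgeWeight_cons]
        set p := ‖f (y :: x :: w)‖
        set q := ‖f (x :: w)‖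
        -- The edge term `2 √S p q` is split by completing a square with the weight `v y` of the
        -- child.
        have h4 : 1 / v y * p ^ 2 + S x y * v y * q ^ 2 - 2 * (√(S x y) * p * q)
            = 1 / v y * (p - √(S x y) * v y * q) ^ 2 := by
          have := (hv y).ne'
          nth_rewrite 1 [← Real.mul_self_sqrt (hS x y)]
          field_simp
          ring
        have h5 : 0 ≤ 1 / v y * (p - √(S x y) * v y * q) ^ 2 :=
          mul_nonneg (one_div_pos.mpr (hv y)).le (sq_nonneg _)
        linarith
    have hfin := hasSum_le hpt (hin.mul_left 2) ((hcs.add hds).hasSum)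
    rw [hcs.tsum_add hds] at hfin
    have h6 : ∑' l, k l * ‖f l‖ ^ 2 + ∑' l, d l * ‖f l‖ ^ 2 ≤ L * ‖f‖ ^ 2 := by
      rw [SeqSpace.norm_sq_eq_tsum, ← hks.tsum_add hds, ← tsum_mul_left]
      refine (hks.add hds).tsum_le_tsum (fun l => ?_) (hsq.mul_left L)
      rw [← add_mul]
      exact mul_le_mul_of_nonneg_right (hkd l) (sq_nonneg _)
    linarith
  exact add_adjoint_le_algebraMap hform

end Tree

/-! ### The resolvent at the roots solves the quadratic vector equation -/

section TreeResolvent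
variable {N : ℕ} {S : Matrix (Fin N) (Fin N) ℝ}

/-- The unit vector at the root `[x]` of a component of the tree. -/
noncomputable def rootVector (x : Fin N) : SeqSpace (List (Fin N)) := lp.single 2 [x] (1 : ℂ)

theorem rootVector_apply (x : Fin N) (l : List (Fin N)) :
    rootVector x l = if l = [x] then 1 else 0 := by
  rw [rootVector, lp.single_apply]
  by_cases h : l = [x]
  · subst h; simp
  · simp [h]

theorem norm_rootVector (x : Fin N) : ‖rootVector x‖ = 1 := by
  rw [rootVector, lp.norm_single (by norm_num)]; simp

/-- The isometries which append `x` to all lists. -/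
theorem exists_append (x : Fin N) :
    ∃ U : SeqSpace (List (Fin N)) →L[ℂ] SeqSpace (List (Fin N)),
      (∀ f w, U f (w ++ [x]) = f w) ∧ ∀ f l, (∀ w, l ≠ w ++ [x]) → U f l = 0 := by
  have hi : Function.Injective fun w : List (Fin N) => w ++ [x] :=
    fun _ _ h => List.append_cancel_right h
  obtain ⟨A, hA⟩ := SeqSpace.exists_weightedComp _ hi (fun _ => 1) 1 (by simp)
  refine ⟨A.adjoint, fun f w => ?_, fun f l hl => ?_⟩
  · simpa using SeqSpace.adjoint_weightedComp_apply hi hA f w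
  · exact SeqSpace.adjoint_weightedComp_apply_of_notMem hA f fun ⟨w, hw⟩ => hl w hw.symm

/-- The orthogonal projection onto the lists which end with `x`. -/
theorem exists_lastProjection (x : Fin N) :
    ∃ D : SeqSpace (List (Fin N)) →L[ℂ] SeqSpace (List (Fin N)),
      ∀ f l, D f l = if l.getLast? = some x then f l else 0 := by
  obtain ⟨A, hA⟩ := SeqSpace.exists_weightedComp (id : List (Fin N) → List (Fin N))
    Function.injective_id (fun l => if l.getLast? = some x then 1 else 0) 1
    (fun w => by split_ifs <;> simp)
  refine ⟨A, fun f l => ?_⟩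
  rw [hA]
  split_ifs <;> simp

variable {T : SeqSpace (List (Fin N)) →L[ℂ] SeqSpace (List (Fin N))}

/-- Edges change only the head of a list of length at least two, so the last letter, which labels
the component, is preserved. -/
theorem treeOperator_comm_lastProjection
    (hT0 : ∀ f, T f [] = 0)
    (hT : ∀ f c w, T f (c :: w) =
      ∑ y, (√(S c y) : ℂ) * f (y :: c :: w) + (edgeWeight S c w : ℂ) * f w)
    {x : Fin N} {D : SeqSpace (List (Fin N)) →L[ℂ] SeqSpace (List (Fin N))}
    (hD : ∀ f l, D f l = if l.getLast? = some x then f l else 0)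
    (f : SeqSpace (List (Fin N))) : T (D f) = D (T f) := by
  ext l
  cases l with
  | nil => simp [hD, hT0]
  | cons c w =>
    rw [hD, hT, hT]
    cases w with
    | nil => by_cases h : c = x <;> simp [hD, h]
    | cons a w =>
      simp only [hD, List.getLast?_cons_cons]
      split_ifs <;> simp

/-- Appending `x` grafts the component of each `[y]` below `[x]`; the only new edges join `[y, x]`
to `[x]` and give the rank-one correction. -/
theorem treeOperator_append
    (hT0 : ∀ f, T f [] = 0)
    (hT : ∀ f c w, T f (c :: w) =
      ∑ y, (√(S c y) : ℂ) * f (y :: c :: w) + (edgeWeight S c w : ℂ) * f w)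
    {x : Fin N} {U : SeqSpace (List (Fin N)) →L[ℂ] SeqSpace (List (Fin N))}
    (hU : ∀ f w, U f (w ++ [x]) = f w) (hU0 : ∀ f l, (∀ w, l ≠ w ++ [x]) → U f l = 0)
    {f : SeqSpace (List (Fin N))} (hf : f [] = 0) :
    T (U f) = U (T f) + (∑ y, (√(S x y) : ℂ) * f [y]) • rootVector x := by
  ext l
  rw [lp.coeFn_add, Pi.add_apply, lp.coeFn_smul, Pi.smul_apply, smul_eq_mul, rootVector_apply]
  rcases List.eq_nil_or_concat' l with rfl | ⟨w, a, rfl⟩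
  · rw [hT0, hU0 _ _ (by simp)]; simp
  by_cases ha : a = x
  · subst ha
    rw [hU]
    cases w with
    | nil =>
      have h (y : Fin N) : U f [y, a] = f [y] := hU f [y]
      simp [hT, hT0, h]
    | cons c w =>
      rw [List.cons_append, hT, hT, hU]
      have h (y : Fin N) : U f (y :: c :: (w ++ [a])) = f (y :: c :: w) := hU f (y :: c :: w)
      simp only [h]
      cases w with
      | nil => simp [hf]
      | cons b w => simp
  · have hcat (w w' : List (Fin N)) : w ++ [a] ≠ w' ++ [x] := fun h =>
      ha (by simpa using (List.append_inj' h rfl).2)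
    have hU' (w) : U f (w ++ [a]) = 0 := hU0 _ _ (hcat w)
    rw [hU0 (T f) _ (hcat w)]
    have hne : w ++ [a] ≠ [x] := hcat w []
    rw [if_neg hne]
    cases w with
    | nil =>
      have h (y : Fin N) : U f [y, a] = 0 := hU' [y]
      simp [hT, h]
    | cons c w =>
      have h (y : Fin N) : U f (y :: c :: (w ++ [a])) = 0 := hU' (y :: c :: w)
      rw [List.cons_append, hT]
      simp [hU', h]

theorem treeOperator_rootVector
    (hT0 : ∀ f, T f [] = 0)
    (hT : ∀ f c w, T f (c :: w) =
      ∑ y, (√(S c y) : ℂ) * f (y :: c :: w) + (edgeWeight S c w : ℂ) * f w)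
    {x : Fin N} {U : SeqSpace (List (Fin N)) →L[ℂ] SeqSpace (List (Fin N))}
    (hU : ∀ f w, U f (w ++ [x]) = f w) (hU0 : ∀ f l, (∀ w, l ≠ w ++ [x]) → U f l = 0) :
    T (rootVector x) = ∑ y, (√(S x y) : ℂ) • U (rootVector y) := by
  have hUr (y : Fin N) (l : List (Fin N)) :
      U (rootVector y) l = if l = [y, x] then 1 else 0 := by
    rcases List.eq_nil_or_concat' l with rfl | ⟨w, a, rfl⟩
    · rw [hU0 _ _ (by simp)]; simp
    · by_cases ha : a = x
      · subst ha
        rw [hU, rootVector_apply]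
        have : w ++ [a] = [y, a] ↔ w = [y] :=
          ⟨fun h => List.append_cancel_right (bs := [a]) (cs := [y]) h, fun h => by simp [h]⟩
        simp only [this]
      · rw [hU0 _ _ fun w' h => ha (by simpa using (List.append_inj' h rfl).2), if_neg]
        exact fun h => ha (by simpa using (List.append_inj' (s₂ := [y]) h rfl).2)
  ext l
  rw [lp.coeFn_sum, Finset.sum_apply]
  simp only [lp.coeFn_smul, Pi.smul_apply, hUr, smul_eq_mul]
  cases l with
  | nil => simp [hT0]
  | cons c w =>
    rw [hT]
    by_cases hw : w = [x]
    · subst hw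
      simp [rootVector_apply]
    · simp [rootVector_apply, hw]

/-- The Schur complement at `[x]`: the resolvent vector of the component is assembled from those of
the subtrees. -/
theorem isQVESolution_of_treeResolvent (hS : ∀ x y, 0 ≤ S x y)
    (hTsa : IsSelfAdjoint T) (hT0 : ∀ f, T f [] = 0)
    (hT : ∀ f c w, T f (c :: w) =
      ∑ y, (√(S c y) : ℂ) * f (y :: c :: w) + (edgeWeight S c w : ℂ) * f w)
    {z : ℂ} (hz : 0 < z.im) {g : Fin N → SeqSpace (List (Fin N))}
    (hg : ∀ x, T (g x) - z • g x = rootVector x) :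
    IsQVESolution S z fun x => inner ℂ (rootVector x) (g x) := by
  have hz0 : z ≠ 0 := fun h => by simp [h] at hz
  have hm (x) : inner ℂ (rootVector x) (g x) = g x [x] := (SeqSpace.apply_eq_inner _ _).symm
  have hpos (x) : 0 < (inner ℂ (rootVector x) (g x)).im := by
    rw [im_inner_resolvent hTsa (hg x)]
    have h : g x ≠ 0 := by
      intro h
      have h1 := hg x
      rw [h, map_zero, smul_zero, sub_zero] at h1
      have h2 := norm_rootVector x
      rw [← h1, norm_zero] at h2
      exact zero_ne_one h2
    have := norm_pos_iff.mpr h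
    positivity
  have hnil (x) : g x [] = 0 := by
    have h := congrArg (fun f : SeqSpace (List (Fin N)) => f []) (hg x)
    simp only [lp.coeFn_sub, Pi.sub_apply, hT0, lp.coeFn_smul, Pi.smul_apply, smul_eq_mul,
      rootVector_apply] at h
    simpa [hz0] using h
  -- The resolvent vector of the root `[x]` stays in its own component.
  have hoff (x y) (hxy : y ≠ x) : g x [y] = 0 := by
    obtain ⟨D, hD⟩ := exists_lastProjection x
    have h1 : D (g x) = g x := by
      apply resolvent_apply_unique hTsa hz.ne'
      rw [treeOperator_comm_lastProjection hT0 hT hD, ← map_smul, ← map_sub, hg]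
      ext l
      rw [hD, rootVector_apply]
      by_cases h : l = [x] <;> simp [h]
    rw [← h1, hD]
    simp [hxy]
  intro x
  refine ⟨hpos x, ?_⟩
  simp only [hm] at hpos ⊢
  obtain ⟨U, hU, hU0⟩ := exists_append x
  set q : ℂ := z + ∑ y, (S x y : ℂ) * g y [y] with hq
  have hq0 : q ≠ 0 := by
    intro h
    have h1 : 0 < q.im := by
      rw [hq, Complex.add_im, Complex.im_sum]
      refine add_pos_of_pos_of_nonneg hz (Finset.sum_nonneg fun y _ => ?_)
      rw [Complex.im_ofReal_mul]
      exact mul_nonneg (hS x y) (hpos y).le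
    simp [h] at h1
  -- `G` equals 1 at the root and is built from the grafted resolvent vectors below it. It solves
  -- the resolvent equation up to the factor `-q`, so evaluation at `[x]` gives `1 = -q * g x [x]`.
  set G : SeqSpace (List (Fin N)) := rootVector x - ∑ y, (√(S x y) : ℂ) • U (g y) with hG
  have hTU (y) : T (U (g y)) = U (rootVector y) + z • U (g y)
      + ((√(S x y) : ℂ) * g y [y]) • rootVector x := by
    rw [treeOperator_append hT0 hT hU hU0 (hnil y), Finset.sum_eq_single y
      (fun y' _ hy' => by rw [hoff y y' hy', mul_zero]) (by simp), ← map_smul, ← map_add, ← hg y,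
      sub_add_cancel]
  have hTG : T G - z • G = (-q) • rootVector x := by
    have h1 : ∑ y, (√(S x y) : ℂ) • T (U (g y)) = ∑ y, (√(S x y) : ℂ) • U (rootVector y)
        + z • ∑ y, (√(S x y) : ℂ) • U (g y) + (∑ y, (S x y : ℂ) * g y [y]) • rootVector x := by
      rw [Finset.smul_sum, Finset.sum_smul, ← Finset.sum_add_distrib, ← Finset.sum_add_distrib]
      refine Finset.sum_congr rfl fun y _ => ?_
      have h2 : (S x y : ℂ) = (√(S x y) : ℂ) * (√(S x y) : ℂ) := by
        rw [← Complex.ofReal_mul, Real.mul_self_sqrt (hS x y)]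
      rw [hTU, h2]
      module
    rw [hG, map_sub, map_sum]
    simp only [map_smul]
    rw [h1, treeOperator_rootVector hT0 hT hU hU0, hq]
    module
  have hgG : G = (-q) • g x := by
    apply resolvent_apply_unique hTsa hz.ne'
    rw [hTG, map_smul, smul_comm z, ← smul_sub, hg]
  have hG1 : G [x] = 1 := by
    have h1 (y) : U (g y) [x] = 0 := by
      rw [← hnil y]; exact hU (g y) []
    rw [hG, lp.coeFn_sub, Pi.sub_apply, lp.coeFn_sum, Finset.sum_apply]
    have h2 (y) : ((√(S x y) : ℂ) • U (g y)) [x] = 0 := by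
      rw [lp.coeFn_smul, Pi.smul_apply, h1, smul_zero]
    rw [Finset.sum_eq_zero fun y _ => h2 y]
    simp [rootVector_apply]
  rw [hgG, lp.coeFn_smul, Pi.smul_apply, smul_eq_mul] at hG1
  have hgx : g x [x] ≠ 0 := fun h => by simp [h] at hG1
  rw [div_eq_iff hgx]
  linear_combination hG1

theorem exists_treeOperator (hS : ∀ x y, 0 ≤ S x y) :
    ∃ T : SeqSpace (List (Fin N)) →L[ℂ] SeqSpace (List (Fin N)), IsSelfAdjoint T ∧
      (∀ z : ℂ, 0 < z.im → ∀ g : Fin N → SeqSpace (List (Fin N)),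
        (∀ x, T (g x) - z • g x = rootVector x) →
          IsQVESolution S z fun x => inner ℂ (rootVector x) (g x)) ∧
      ∀ (v : Fin N → ℝ) (L : ℝ), (∀ x, 0 < v x) → 0 ≤ L →
        (∀ x, 1 / v x + ∑ y, S x y * v y ≤ L) → T ≤ algebraMap ℝ _ L := by
  obtain ⟨P, hP, hP0, hPc⟩ := exists_treeShift S
  refine ⟨P + P.adjoint, IsSelfAdjoint.add_star_self P, fun z hz g hg => ?_,
    fun v L hv hL hvL => treeShift_add_adjoint_le hS hP hv hL hvL⟩
  have hadd (f : SeqSpace (List (Fin N))) (l : List (Fin N)) :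
      (P + P.adjoint) f l = P f l + P.adjoint f l := rfl
  refine isQVESolution_of_treeResolvent hS (IsSelfAdjoint.add_star_self P) (fun f => ?_)
    (fun f c w => ?_) hz hg
  · exact (hadd f []).trans (by rw [hP0, hP]; simp)
  · exact (hadd f _).trans (by rw [hPc, hP]; simp)

end TreeResolvent

/-! ### The mean spectral measure at finitely many unit vectors -/

section VectorState
variable {H : Type*} [NormedAddCommGroup H] [InnerProductSpace ℂ H] {N : ℕ} (e : Fin N → H)

/-- The expectation of an operator, averaged over the vectors `e`. -/
noncomputable def meanState : (H →L[ℂ] H) →ₗ[ℝ] ℝ where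
  toFun a := (N : ℝ)⁻¹ * ∑ x, (inner ℂ (e x) (a (e x))).re
  map_add' a b := by
    simp only [add_apply, inner_add_right, Complex.add_re, Finset.sum_add_distrib, mul_add]
  map_smul' c a := by
    have h (x : Fin N) : (inner ℂ (e x) ((c • a) (e x))).re
        = c * (inner ℂ (e x) (a (e x))).re := by
      have h1 : (c • a) (e x) = (c : ℂ) • a (e x) := by
        rw [Complex.coe_smul]; rfl
      rw [h1, inner_smul_right, Complex.re_ofReal_mul]
    simp only [h, ← Finset.mul_sum, RingHom.id_apply, smul_eq_mul]
    ring

theorem meanState_apply (a : H →L[ℂ] H) :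
    meanState e a = (N : ℝ)⁻¹ * ∑ x, (inner ℂ (e x) (a (e x))).re :=
  rfl

variable {e}

theorem meanState_one (hN : 0 < N) (he : ∀ x, ‖e x‖ = 1) : meanState e 1 = 1 := by
  have h (x : Fin N) : (inner ℂ (e x) (e x)).re = 1 := by
    rw [inner_self_eq_norm_sq_to_K, he]; simp
  rw [meanState_apply]
  simp only [one_apply_eq_self, h]
  simp [hN.ne']

theorem meanState_nonneg {a : H →L[ℂ] H} (ha : 0 ≤ a) : 0 ≤ meanState e a := by
  rw [meanState_apply]
  refine mul_nonneg (by positivity) (Finset.sum_nonneg fun x _ => ?_)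
  exact ((ContinuousLinearMap.nonneg_iff_isPositive a).mp ha).re_inner_nonneg_right _

variable [CompleteSpace H]

/-- The mean of the spectral measures of a self-adjoint operator at unit vectors. -/
theorem exists_mean_spectralMeasure (hN : 0 < N) (he : ∀ x, ‖e x‖ = 1) {T : H →L[ℂ] H}
    (hT : IsSelfAdjoint T) : ∃ ρ : Measure ℝ, IsProbabilityMeasure ρ ∧
      (∀ L : ℝ, T ≤ algebraMap ℝ (H →L[ℂ] H) L → ρ.support ⊆ Set.Iic L) ∧
      ∀ (τ η : ℝ) (g : Fin N → H), 0 < η →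
        (∀ x, T (g x) - ((τ : ℂ) + η * Complex.I) • g x = e x) →
          ∫ t, η / ((t - τ) ^ 2 + η ^ 2) ∂ρ = (N : ℝ)⁻¹ * ∑ x, (inner ℂ (e x) (g x)).im := by
  obtain ⟨ρ, hρ, hρs, hρi⟩ := exists_spectralMeasure T hT (meanState e)
    (fun a ha => meanState_nonneg ha) (meanState_one hN he)
  refine ⟨ρ, hρ, fun L hL => ?_, fun τ η g hη hg => ?_⟩
  · have hcl : IsClosed (spectrum ℝ T) :=
      (ContinuousFunctionalCalculus.isCompact_spectrum T).isClosed
    refine (Measure.support_subset_of_isClosed hcl hρs).trans fun t ht => ?_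
    exact (le_algebraMap_iff_spectrum_le hT).mp hL t ht
  · have hpos (t : ℝ) : (t - τ) ^ 2 + η ^ 2 ≠ 0 := by positivity
    rw [hρi _ (by fun_prop (disch := assumption)), meanState_apply]
    congr 1
    refine Finset.sum_congr rfl fun x _ => ?_
    rw [im_inner_resolvent hT (hg x), ← norm_sq_resolvent hT hη (hg x)]
    simp

end VectorState

/-! ### Existence and uniqueness of the density of states -/

section DensityOfStates
variable {N : ℕ} {S : Matrix (Fin N) (Fin N) ℝ}

theorem exists_isSelfConsistentDOS (hN : 0 < N) (hS : ∀ x y, 0 ≤ S x y) :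
    (∀ z : ℂ, 0 < z.im → ∃ m, IsQVESolution S z m) ∧
    ∃ ρ : Measure ℝ, IsSelfConsistentDOS S ρ ∧
      ∀ (v : Fin N → ℝ) (L : ℝ), (∀ x, 0 < v x) → 0 ≤ L →
        (∀ x, 1 / v x + ∑ y, S x y * v y ≤ L) → ρ.support ⊆ Set.Iic L := by
  obtain ⟨T, hT, hsol, hle⟩ := exists_treeOperator hS
  have hex (z : ℂ) : ∃ g : Fin N → SeqSpace (List (Fin N)), 0 < z.im →
      ∀ x, T (g x) - z • g x = rootVector x := by
    by_cases hz : 0 < z.im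
    · choose g hg using fun x => exists_resolvent_apply hT hz.ne' (rootVector x)
      exact ⟨g, fun _ => hg⟩
    · exact ⟨0, fun h => absurd h hz⟩
  choose g hg using hex
  refine ⟨fun z hz => ⟨_, hsol z hz _ (hg z hz)⟩, ?_⟩
  obtain ⟨ρ, hρ, hρs, hρi⟩ := exists_mean_spectralMeasure hN norm_rootVector hT
  refine ⟨ρ, ⟨hρ, fun z x => inner ℂ (rootVector x) (g z x), fun z hz => hsol z hz _ (hg z hz),
    fun f hf hfc => ?_⟩, fun v L hv hL hvL => hρs L (hle v L hv hL hvL)⟩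
  refine (tendsto_integral_mul_poisson ρ hf hfc).congr' ?_
  filter_upwards [self_mem_nhdsWithin] with η hη
  rw [Set.mem_Ioi] at hη
  congr 1
  ext τ
  rw [hρi τ η _ hη (hg _ (by simpa using hη))]
  ring

/-- The two witnesses `m` agree on the upper half plane, so both measures are the same vague limit.
-/
theorem IsSelfConsistentDOS.unique (hS : ∀ x y, 0 ≤ S x y) {ρ ρ' : Measure ℝ}
    (h : IsSelfConsistentDOS S ρ) (h' : IsSelfConsistentDOS S ρ') : ρ = ρ' := by
  have := h.isProbabilityMeasure
  have := h'.isProbabilityMeasure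
  obtain ⟨m, hm, hlim⟩ := h.isLimit
  obtain ⟨m', hm', hlim'⟩ := h'.isLimit
  refine Measure.ext_of_integral_eq_on_compactlySupported fun f => ?_
  refine tendsto_nhds_unique (hlim f f.continuous f.hasCompactSupport)
    ((hlim' f f.continuous f.hasCompactSupport).congr' ?_)
  filter_upwards [self_mem_nhdsWithin] with η hη
  rw [Set.mem_Ioi] at hη
  congr 1
  ext τ
  have hz : 0 < ((τ : ℂ) + (η : ℂ) * Complex.I).im := by simpa using hη
  rw [(hm' _ hz).unique hS hz (hm _ hz)]

end DensityOfStates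

/-! ### The main theorem -/

theorem theorem1p1 (N : ℕ) (hN : 0 < N) (S : Matrix (Fin N) (Fin N) ℝ)
    (hsymm : S.IsSymm) (hnonneg : ∀ x y, 0 ≤ S x y) :
    -- the quadratic vector equation has a unique solution and defines a unique measure
    (∀ z : ℂ, 0 < z.im → ∃! m : Fin N → ℂ, IsQVESolution S z m) ∧
    (∃! ρ : Measure ℝ, IsSelfConsistentDOS S ρ) ∧
    -- the bound on the maximum of its support
    ∀ ρ : Measure ℝ, IsSelfConsistentDOS S ρ → ∀ J : ℕ∞,
      ∃ w_c r : ℝ, IsLeast (phiPosRoots S J) w_c ∧ IsGreatest ρ.support r ∧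
        r ≤ 2 * √‖S‖ / w_c ∧
        -- comparison with the bound `2 * √‖S‖`
        1 ≤ w_c ∧ ((∃ j : ℕ, 1 ≤ j ∧ (j : ℕ∞) ≤ J ∧ normRatio S j < 1) → 1 < w_c) := by
  obtain ⟨hex, ρ₀, hρ₀, hsupp⟩ := exists_isSelfConsistentDOS hN hnonneg
  refine ⟨fun z hz => ?_, ⟨ρ₀, hρ₀, fun ρ hρ => hρ.unique hnonneg hρ₀⟩, fun ρ hρ J => ?_⟩
  · obtain ⟨m, hm⟩ := hex z hz
    exact ⟨m, hm, fun m' hm' => hm'.unique hnonneg hz hm⟩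
  obtain rfl := hρ.unique hnonneg hρ₀
  have := hρ.isProbabilityMeasure
  obtain ⟨w, hw⟩ := exists_isLeast_phiPosRoots S J
  have hw1 := one_le_of_mem_phiPosRoots S hw.1
  have hw0 : 0 < w := zero_lt_one.trans_le hw1
  have hbound : ρ.support ⊆ Set.Iic (2 * √‖S‖ / w) := by
    -- For `S = 0` the bound is 0 and no supersolution attains it; the constants `v = 1 / ε` give
    -- the bound `ε` for every `ε > 0`.
    by_cases hS0 : S = 0
    · intro t ht
      refine Set.mem_Iic.mpr (le_of_forall_pos_le_add fun ε hε => ?_)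
      have : t ≤ ε := hsupp (fun _ => 1 / ε) ε (fun _ => one_div_pos.mpr hε) hε.le
        (fun x => by simp [hS0]) ht
      simpa [hS0] using this
    · obtain ⟨-, hs, hroot⟩ := (mem_phiPosRoots_iff S J w).mp hw.1
      obtain ⟨v, hv, hvL⟩ := exists_supersolution hnonneg hS0 (normRatio_le_phiCoeff S J)
        (u := w / 2) (by positivity) hs hroot
      have h : √‖S‖ / (w / 2) = 2 * √‖S‖ / w := by field_simp
      rw [h] at hvL
      exact hsupp v _ hv (by positivity) hvL
  have hne : ρ.support.Nonempty := Measure.nonempty_support (IsProbabilityMeasure.ne_zero ρ)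
  have hgreatest : IsGreatest ρ.support (sSup ρ.support) :=
    ⟨Measure.isClosed_support.csSup_mem hne ⟨_, hbound⟩, fun t ht => le_csSup ⟨_, hbound⟩ ht⟩
  exact ⟨w, sSup ρ.support, hw, hgreatest, hbound hgreatest.1, hw1,
    one_lt_of_mem_phiPosRoots S hw.1⟩
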